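/- Let $M\ge 1$ and let $\rho,\ \mu_1,\dots,\mu_M,\ x_1,\dots,x_M,\ \xi_1,\dots,\xi_M,\ z_1,\dots,z_M$ be complex numbers with all $x_k\neq 0$. Fix a complex square root of each of these numbers, and read $\sqrt{\mu\xi}$ as $\sqrt{\mu}\sqrt{\xi}$, $\sqrt{z/x}$ as $\sqrt z/\sqrt x$, and $(z/x)^{n/2}$ as $(\sqrt z/\sqrt x)^n$. Consider the asymmetric (trigonometric) six-vertex model with electric fields, with $R$-matrix on $\mathbb C^2\otimes\mathbb C^2$ (basis $e_0\otimes e_0,\ e_0\otimes e_1,\ e_1\otimes e_0,\ e_1\otimes e_1$) $$R\begin{pmatrix}\mu&\xi\\ x&z\end{pmatrix}=\begin{pmatrix}1&0&0&0\\ 0&\frac{\sqrt\rho}{x}\frac{\mu-\xi}{\mu\rho-\xi}&(\rho-1)\sqrt{\frac zx}\,\frac{\sqrt{\mu\xi}}{\mu\rho-\xi}&0\\ 0&(\rho-1)\sqrt{\frac zx}\,\frac{\sqrt{\mu\xi}}{\mu\rho-\xi}&\sqrt\rho\, z\,\frac{\mu-\xi}{\mu\rho-\xi}&0\\ 0&0&0&\frac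 zx\end{pmatrix}.$$ On $\mathbb C^2_a\otimes(\mathbb C^2)^{\otimes M}$ form the monodromy matrix $$R_{aM}\begin{pmatrix}\mu&\xi_M\\ x&z_M\end{pmatrix}\cdots R_{a1}\begin{pmatrix}\mu&\xi_1\\ x&z_1\end{pmatrix}=\begin{pmatrix}A\binom{\mu}{x}&B\binom{\mu}{x}\\ C\binom{\mu}{x}&D\binom{\mu}{x}\end{pmatrix}_a,$$ put $|0\rangle=e_0^{\otimes M}$, $|1\rangle=e_1^{\otimes M}$, with $\langle 0|,\langle 1|$ their transposes, and define the domain wall partition functions $$Z^{(B)}_M\begin{pmatrix}\{\mu\}&\{\xi\}\\ \{x\}&\{z\}\end{pmatrix}=\langle 1|B\tbinom{\mu_1}{x_1}\cdots B\tbinom{\mu_M}{x_M}|0\rangle,\qquad Z^{(C)}_M\begin{pmatrix}\{\nu\}&\{\xi\}\\ \{y\}&\{z\}\end{pmatrix}=\langle 0|C\tbinom{\nu_M}{y_M}\cdots C\tbinom{\nu_1}{y_1}|1\rangle .$$ Let $$Z^{(\mathrm{Izer})}_M(\{\mu\},\{\xi\})=\frac{\prod_{k=1}^M\sqrt{\mu_k\xi_k}\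 \prod_{m,n=1}^M(\mu_m-\xi_n)}{\prod_{1\le p<q\le M}(\mu_p-\mu_q)(\xi_q-\xi_p)}\ \det\left[\frac{\rho-1}{(\mu_i\rho-\xi_j)(\mu_i-\xi_j)}\right]_{i,j=1}^M .$$ Assume that the $\mu_i$ are pairwise distinct, that the $\xi_j$ are pairwise distinct, and that $\mu_i\neq\xi_j$ and $\mu_i\rho\neq\xi_j$ for all $i,j$. Then $$Z^{(B)}_M\begin{pmatrix}\{\mu\}&\{\xi\}\\ \{x\}&\{z\}\end{pmatrix}=\prod_{k=1}^M\left(\frac{z_k}{x_k}\right)^{\frac{2M-2k+1}{2}}Z^{(\mathrm{Izer})}_M(\{\mu\},\{\xi\}).$$ Likewise, if $\nu_1,\dots,\nu_M$ and nonzero $y_1,\dots,y_M$ (with chosen square roots) satisfy the same assumptions in place of the $\mu_i$ and $x_i$, then $$Z^{(C)}_M\begin{pmatrix}\{\nu\}&\{\xi\}\\ \{y\}&\{z\}\end{pmatrix}=\prod_{k=1}^M\left(\frac{z_{M+1-k}}{y_k}\right)^{\frac{2M-2k+1}{2}}Z^{(\mathrm{Izer})}_M(\{\nu\},\{\xi\}).$$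 -/

import Mathlib

namespace SixVertex

/-- The two complex parameters carried by a line of the lattice (a rapidity or an inhomogeneity):
an additive spectral parameter (`μ` or `ξ`) and a non-additive electric field (`x` or `z`),
each with a chosen complex square root. The roots fix the branches in the formulas below:
`√(μ ξ)` means `√μ * √ξ`, and `√(z / x)` means `√z / √x`. -/
structure LineParam where
  spec : ℂ
  field : ℂ
  sqrtSpec : ℂ
  sqrtField : ℂ
  sq_sqrtSpec : sqrtSpec ^ 2 = spec
  sq_sqrtField : sqrtField ^ 2 = field

/-- The `4 × 4` array of Boltzmann weights of the asymmetric six-vertex model with anisotropy `ρ`,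
`sρ` being a square root of `ρ`; `u` carries `(μ, x)` and `v` carries `(ξ, z)`. -/
noncomputable def weights (ρ sρ : ℂ) (u v : LineParam) : Matrix (Fin 4) (Fin 4) ℂ :=
  !![1, 0, 0, 0;
     0, sρ / u.field * ((u.spec - v.spec) / (u.spec * ρ - v.spec)),
        (ρ - 1) * (v.sqrtField / u.sqrtField) *
          (u.sqrtSpec * v.sqrtSpec / (u.spec * ρ - v.spec)), 0;
     0, (ρ - 1) * (v.sqrtField / u.sqrtField) *
          (u.sqrtSpec * v.sqrtSpec / (u.spec * ρ - v.spec)),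
        sρ * v.field * ((u.spec - v.spec) / (u.spec * ρ - v.spec)), 0;
     0, 0, 0, v.field / u.field]

/-- The `R`-matrix on `ℂ² ⊗ ℂ²`, in the basis
`e₀ ⊗ e₀, e₀ ⊗ e₁, e₁ ⊗ e₀, e₁ ⊗ e₁` (the index `(a, s)` has position `s + 2 * a`). -/
noncomputable def RMatrix (ρ sρ : ℂ) (u v : LineParam) :
    Matrix (Fin 2 × Fin 2) (Fin 2 × Fin 2) ℂ :=
  (weights ρ sρ u v).submatrix finProdFinEquiv finProdFinEquiv

/-- `R_{aj}`: the `R`-matrix acting on the auxiliary space `ℂ²` and the `j`-th factor of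
`(ℂ²)^{⊗ L}`, and as the identity on the other factors. Basis vectors of `(ℂ²)^{⊗ L}` are
indexed by `Fin L → Fin 2`. -/
noncomputable def siteR {L : ℕ} (ρ sρ : ℂ) (u : LineParam) (v : Fin L → LineParam) (j : Fin L) :
    Matrix (Fin 2 × (Fin L → Fin 2)) (Fin 2 × (Fin L → Fin 2)) ℂ :=
  Matrix.of fun p q =>
    if ∀ k, k ≠ j → p.2 k = q.2 k then RMatrix ρ sρ u (v j) (p.1, p.2 j) (q.1, q.2 j) else 0

/-- The monodromy matrix `R_{aL} ⋯ R_{a2} R_{a1}`. -/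
noncomputable def monodromy {L : ℕ} (ρ sρ : ℂ) (u : LineParam) (v : Fin L → LineParam) :
    Matrix (Fin 2 × (Fin L → Fin 2)) (Fin 2 × (Fin L → Fin 2)) ℂ :=
  (List.ofFn fun j => siteR ρ sρ u v j).reverse.prod

/-- The upper right block of the monodromy matrix `(A B; C D)` over the auxiliary space. -/
noncomputable def opB {L : ℕ} (ρ sρ : ℂ) (u : LineParam) (v : Fin L → LineParam) :
    Matrix (Fin L → Fin 2) (Fin L → Fin 2) ℂ :=
  Matrix.of fun s t => monodromy ρ sρ u v (0, s) (1, t)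

/-- The lower left block of the monodromy matrix `(A B; C D)` over the auxiliary space. -/
noncomputable def opC {L : ℕ} (ρ sρ : ℂ) (u : LineParam) (v : Fin L → LineParam) :
    Matrix (Fin L → Fin 2) (Fin L → Fin 2) ℂ :=
  Matrix.of fun s t => monodromy ρ sρ u v (1, s) (0, t)

/-- The type-`B` domain wall partition function `⟨1| B(u₁) ⋯ B(u_M) |0⟩`, where
`|0⟩ = e₀ ⊗ ⋯ ⊗ e₀` and `⟨1|` is the transpose of `e₁ ⊗ ⋯ ⊗ e₁`. -/
noncomputable def dwpfB {M : ℕ} (ρ sρ : ℂ) (u v : Fin M → LineParam) : ℂ :=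
  (List.ofFn fun i => opB ρ sρ (u i) v).prod (fun _ => 1) (fun _ => 0)

/-- The type-`C` domain wall partition function `⟨0| C(u_M) ⋯ C(u₁) |1⟩`. -/
noncomputable def dwpfC {M : ℕ} (ρ sρ : ℂ) (u v : Fin M → LineParam) : ℂ :=
  (List.ofFn fun i => opC ρ sρ (u i) v).reverse.prod (fun _ => 0) (fun _ => 1)

/-- The Izergin–Korepin determinant expression `Z^{(Izer)}_M({μ}, {ξ})`. -/
noncomputable def izergin {M : ℕ} (ρ : ℂ) (u v : Fin M → LineParam) : ℂ :=
  ((∏ k, (u k).sqrtSpec * (v k).sqrtSpec) * ∏ m, ∏ n, ((u m).spec - (v n).spec)) /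
    (∏ p, ∏ q ∈ Finset.Ioi p, ((u p).spec - (u q).spec) * ((v q).spec - (v p).spec)) *
    (Matrix.of fun i j : Fin M =>
      (ρ - 1) / (((u i).spec * ρ - (v j).spec) * ((u i).spec - (v j).spec))).det

end SixVertex

/-! ### Exchange relations and their stability under adding a site. -/

namespace SixVertex

/-! Row fields are a gauge. `B` raises the number of up spins by one, so each row field contributes
only a power of its square root fixed by the charges (`monodromy_eq_topRow`, `prod_opB_eq`). What is
left is a row depending on a square root `q` of the anisotropy and a square root `r` of the
rapidity. Its entries `A`, `B` obey exchange relations whose coefficients involve neither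
inhomogeneities nor column fields (`exchange_topRow`), so the algebraic Bethe ansatz applies.

Splitting off one site and moving `A` through the `B`'s to the reference state (`A_mul_bethe`,
`blockB_bethe`) gives a sum over the row that carries the off-diagonal weight at that site, hence a
recursion lowering the size by one. The Izergin expression obeys the same recursion: expand its
determinant along the first column and rewrite the sum by polynomial interpolation in that column's
parameter (`izergin_interpolation`, `izergin_succ`). Induction identifies the two
(`bethe_eq_izergin`).

The exchange coefficients divide by `q`, so `q = 0` is reached by continuity (`dwpfB_eq`). For type
`C`, symmetry of the `R`-matrix lets transposition turn `C` into `B` with the sites reversed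
(`dwpfC_eq_dwpfB`), and the Izergin expression does not depend on the order of the columns
(`izergin_comp_perm`). -/

/-- The coefficient of the direct term in the exchange relation of `A` and `B`. -/
noncomputable def exchangeDirect (q r k : ℂ) : ℂ := (k ^ 2 * q ^ 2 - r ^ 2) / (q * (k ^ 2 - r ^ 2))

/-- The coefficient of the exchanged term in the exchange relation of `A` and `B`. -/
noncomputable def exchangeSwap (q r k : ℂ) : ℂ := -((q ^ 2 - 1) * r * k) / (q * (k ^ 2 - r ^ 2))

/-- The exchange relations between the top-row monodromy entries of two rows, the row
parameters being given through the square roots `r`, `k` of the rapidities. -/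
structure Exchange {R : Type*} [Ring R] [Algebra ℂ R] (q r k : ℂ) (A B A' B' : R) : Prop where
  comm_A : A * A' = A' * A
  comm_B : B * B' = B' * B
  A_mul_B' : A * B' = exchangeDirect q r k • (B' * A) + exchangeSwap q r k • (B * A')
  A'_mul_B : A' * B = exchangeDirect q k r • (B * A') + exchangeSwap q k r • (B' * A)

/-- The diagonal weight of a site, the two lines being given by square roots of rapidities. -/
noncomputable def weightB (q r s : ℂ) : ℂ := q * (r ^ 2 - s ^ 2) / (r ^ 2 * q ^ 2 - s ^ 2)

/-- The off-diagonal weight of a site, with the square root `y` of the column field. -/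
noncomputable def weightC (q r s y : ℂ) : ℂ := (q ^ 2 - 1) * y * (r * s) / (r ^ 2 * q ^ 2 - s ^ 2)

/-- The operator `A` with one more site. -/
noncomputable def blockA {R : Type*} [Ring R] [Algebra ℂ R] (q r s y : ℂ) (A B : R) :
    Matrix (Fin 2) (Fin 2) R :=
  !![A, weightC q r s y • B; 0, weightB q r s • A]

/-- The operator `B` with one more site. -/
noncomputable def blockB {R : Type*} [Ring R] [Algebra ℂ R] (q r s y : ℂ) (A B : R) :
    Matrix (Fin 2) (Fin 2) R :=
  !![(y ^ 2 * weightB q r s) • B, 0; weightC q r s y • A, y ^ 2 • B]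

/-- Every block entry is put in normal order by the old relations. Comparing coefficients then
leaves rational identities in the weights, in which `s` and `y` drop out of the exchange
coefficients. -/
theorem Exchange.block {R : Type*} [Ring R] [Algebra ℂ R] {q r k : ℂ} {A B A' B' : R}
    (h : Exchange q r k A B A' B') (s y : ℂ) (hq : q ≠ 0) (hrk : r ^ 2 ≠ k ^ 2)
    (hr : r ^ 2 * q ^ 2 ≠ s ^ 2) (hk : k ^ 2 * q ^ 2 ≠ s ^ 2) :
    Exchange q r k (blockA q r s y A B) (blockB q r s y A B)
      (blockA q k s y A' B') (blockB q k s y A' B') := by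
  obtain ⟨hA, hB, h1, h2⟩ := h
  have e1 : r ^ 2 - k ^ 2 ≠ 0 := sub_ne_zero.2 hrk
  have e2 : k ^ 2 - r ^ 2 ≠ 0 := sub_ne_zero.2 hrk.symm
  have e3 : r ^ 2 * q ^ 2 - s ^ 2 ≠ 0 := sub_ne_zero.2 hr
  have e4 : k ^ 2 * q ^ 2 - s ^ 2 ≠ 0 := sub_ne_zero.2 hk
  have e5 : q ^ 2 * r ^ 2 - s ^ 2 ≠ 0 := by rwa [mul_comm]
  have e6 : q ^ 2 * k ^ 2 - s ^ 2 ≠ 0 := by rwa [mul_comm]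
  unfold blockA blockB
  constructor <;> ext i j <;> fin_cases i <;> fin_cases j <;>
    simp [Matrix.mul_apply, Fin.sum_univ_two, hA, hB, h1, h2]
  all_goals (match_scalars <;> simp only [exchangeDirect, exchangeSwap, weightB, weightC] <;> field_simp <;> ring)

/-- In `A_mul_bethe`, row `c` can be exchanged directly or through an intermediate row `b`; the two
contributions add up to a single product. -/
theorem exchange_swap_identity {q a b c : ℂ} (hq : q ≠ 0) (hab : a ^ 2 ≠ b ^ 2) (hac : a ^ 2 ≠ c ^ 2)
    (hbc : b ^ 2 ≠ c ^ 2) :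
    exchangeDirect q a b * exchangeSwap q a c + exchangeSwap q a b * exchangeSwap q b c =
      exchangeSwap q a c * exchangeDirect q c b := by
  have e1 := sub_ne_zero.2 hab.symm
  have e2 := sub_ne_zero.2 hac.symm
  have e3 := sub_ne_zero.2 hbc.symm
  have e4 := sub_ne_zero.2 hbc
  simp only [exchangeDirect, exchangeSwap]
  field_simp
  ring

/-- The analogue for `blockB_bethe`: the off-diagonal weight sits on row `k` already, or reaches it
by an exchange with the newly added row `r`. -/
theorem weight_swap_identity {q r k s y : ℂ} (hq : q ≠ 0) (hrk : r ^ 2 ≠ k ^ 2)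
    (hr : r ^ 2 * q ^ 2 ≠ s ^ 2) (hk : k ^ 2 * q ^ 2 ≠ s ^ 2) :
    weightC q r s y * weightB q k s * exchangeSwap q r k + weightC q k s y =
      weightC q k s y * (weightB q r s * exchangeDirect q k r) := by
  have e1 : r ^ 2 - k ^ 2 ≠ 0 := sub_ne_zero.2 hrk
  have e2 : k ^ 2 - r ^ 2 ≠ 0 := sub_ne_zero.2 hrk.symm
  have e3 : r ^ 2 * q ^ 2 - s ^ 2 ≠ 0 := sub_ne_zero.2 hr
  have e4 : k ^ 2 * q ^ 2 - s ^ 2 ≠ 0 := sub_ne_zero.2 hk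
  have e5 : q ^ 2 * r ^ 2 - s ^ 2 ≠ 0 := by rwa [mul_comm]
  have e6 : q ^ 2 * k ^ 2 - s ^ 2 ≠ 0 := by rwa [mul_comm]
  simp only [exchangeDirect, exchangeSwap, weightB, weightC]
  field_simp
  ring

/-! ### Bethe ansatz in an abstract algebra. -/

section Bethe

variable {R ι : Type*} [Ring R] [Algebra ℂ R] [DecidableEq ι] {q : ℂ} {r : ι → ℂ} {A B : ι → R}

/-- The action of `A` on a product of `B` operators applied to a reference state `Ω`. -/
theorem A_mul_bethe (hq : q ≠ 0) (hr : ∀ i j, i ≠ j → r i ^ 2 ≠ r j ^ 2)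
    (hex : ∀ i j, i ≠ j → Exchange q (r i) (r j) (A i) (B i) (A j) (B j))
    {Ψ : Finset ι → R} (hA : ∀ i, A i * Ψ ∅ = Ψ ∅)
    (hB : ∀ (S : Finset ι), ∀ i ∉ S, Ψ (insert i S) = B i * Ψ S) (S : Finset ι) :
    ∀ i ∉ S, A i * Ψ S = (∏ k ∈ S, exchangeDirect q (r i) (r k)) • Ψ S +
      ∑ l ∈ S, (exchangeSwap q (r i) (r l) *
        ∏ k ∈ S.erase l, exchangeDirect q (r l) (r k)) • Ψ (insert i (S.erase l)) := by
  induction S using Finset.induction_on with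
  | empty => intro i _; simp [hA]
  | insert j S hj ih =>
    intro i hi
    rw [Finset.mem_insert, not_or] at hi
    obtain ⟨hij, hiS⟩ := hi
    have hji : j ≠ i := fun h => hij h.symm
    have h1 : ∀ l ∈ S, Ψ (insert i ((insert j S).erase l)) = B j * Ψ (insert i (S.erase l)) := by
      intro l hl
      have hlj : j ≠ l := fun h => hj (h ▸ hl)
      rw [Finset.erase_insert_of_ne hlj, Finset.insert_comm, hB]
      simp [hji, hj]
    have h2 : ∀ l ∈ S, B i * Ψ (insert j (S.erase l)) = B j * Ψ (insert i (S.erase l)) := by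
      intro l hl
      rw [← hB, ← hB, Finset.insert_comm] <;> simp [hji, hj, hij, hiS]
    rw [hB S j hj, ← mul_assoc, (hex i j hij).A_mul_B', add_mul, smul_mul_assoc, smul_mul_assoc,
      mul_assoc, mul_assoc, ih i hiS, ih j hj, Finset.prod_insert hj, Finset.sum_insert hj,
      Finset.erase_insert hj, hB S i hiS]
    -- A state in which `i` replaces `l` arises from both terms of the exchange relation;
    -- `exchange_swap_identity` merges the coefficients.
    have h3 : ∑ l ∈ S, (exchangeSwap q (r i) (r l) *
        ∏ k ∈ (insert j S).erase l, exchangeDirect q (r l) (r k)) •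
          Ψ (insert i ((insert j S).erase l)) =
        exchangeDirect q (r i) (r j) • ∑ l ∈ S, (exchangeSwap q (r i) (r l) *
          ∏ k ∈ S.erase l, exchangeDirect q (r l) (r k)) • (B j * Ψ (insert i (S.erase l))) +
        exchangeSwap q (r i) (r j) • ∑ l ∈ S, (exchangeSwap q (r j) (r l) *
          ∏ k ∈ S.erase l, exchangeDirect q (r l) (r k)) • (B i * Ψ (insert j (S.erase l))) := by
      rw [Finset.smul_sum, Finset.smul_sum, ← Finset.sum_add_distrib]
      refine Finset.sum_congr rfl fun l hl => ?_
      have hlj : j ≠ l := fun h => hj (h ▸ hl)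
      have hli : i ≠ l := fun h => hiS (h ▸ hl)
      rw [h1 l hl, h2 l hl, Finset.erase_insert_of_ne hlj, Finset.prod_insert (by simp [hj]),
        smul_smul, smul_smul, ← add_smul]
      congr 1
      have := exchange_swap_identity hq (hr i j hij) (hr i l hli) (hr j l hlj)
      linear_combination (-∏ k ∈ S.erase l, exchangeDirect q (r l) (r k)) * this
    rw [h3]
    simp only [mul_add, Finset.mul_sum, mul_smul_comm]
    module

/-- Splitting off one site from a product of `B` operators applied to the reference state. -/
theorem blockB_bethe (hq : q ≠ 0) (hr : ∀ i j, i ≠ j → r i ^ 2 ≠ r j ^ 2)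
    (hex : ∀ i j, i ≠ j → Exchange q (r i) (r j) (A i) (B i) (A j) (B j))
    {Ψ : Finset ι → R} (hA : ∀ i, A i * Ψ ∅ = Ψ ∅)
    (hB : ∀ (S : Finset ι), ∀ i ∉ S, Ψ (insert i S) = B i * Ψ S) (s y : ℂ)
    (hs : ∀ i, r i ^ 2 * q ^ 2 ≠ s ^ 2) {Φ : Finset ι → Matrix (Fin 2) (Fin 2) R}
    (hΦ : Φ ∅ = !![Ψ ∅, 0; 0, 0])
    (hΦB : ∀ (S : Finset ι), ∀ i ∉ S, Φ (insert i S) = blockB q (r i) s y (A i) (B i) * Φ S)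
    (S : Finset ι) :
    Φ S = !![(∏ k ∈ S, y ^ 2 * weightB q (r k) s) • Ψ S, 0;
      ∑ l ∈ S, (weightC q (r l) s y * ∏ k ∈ S.erase l,
        (y ^ 2 * (weightB q (r k) s * exchangeDirect q (r l) (r k)))) • Ψ (S.erase l), 0] := by
  induction S using Finset.induction_on with
  | empty => simp [hΦ]
  | insert j S hj ih =>
    rw [hΦB S j hj, ih, blockB]
    ext a b
    fin_cases a <;> fin_cases b <;> simp [Matrix.mul_apply, Fin.sum_univ_two]
    · rw [hB S j hj, Finset.prod_insert hj, smul_smul, mul_comm]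
    -- The direct term of `A` is the new summand `l = j`; its exchanged terms correct the summands
    -- with `l ∈ S`.
    · rw [A_mul_bethe hq hr hex hA hB S j hj, Finset.sum_insert hj, Finset.erase_insert hj]
      simp only [smul_add, Finset.smul_sum, Finset.mul_sum, mul_smul_comm, smul_smul]
      rw [add_assoc, ← Finset.sum_add_distrib]
      congr 1
      · congr 1
        simp only [Finset.prod_mul_distrib]
        ring
      · refine Finset.sum_congr rfl fun l hl => ?_
        have hlj : j ≠ l := fun h => hj (h ▸ hl)
        have hjl : j ∉ S.erase l := by simp [hj]
        rw [Finset.erase_insert_of_ne hlj, Finset.prod_insert hjl, ← hB _ _ hjl, ← add_smul]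
        congr 1
        have := weight_swap_identity (y := y) hq (hr j l hlj) (hs j) (hs l)
        rw [← Finset.mul_prod_erase S _ hl]
        simp only [Finset.prod_mul_distrib]
        linear_combination (y ^ 2 * (∏ k ∈ S.erase l, y ^ 2) * (∏ k ∈ S.erase l, weightB q (r k) s) *
          ∏ k ∈ S.erase l, exchangeDirect q (r l) (r k)) * this

end Bethe

/-! ### Recursion and column symmetry of the Izergin determinant. -/

open Polynomial in
/-- A Lagrange interpolation identity for the expansion of the Izergin determinant along a
column, as a function of the column parameter `X`. -/
theorem izergin_interpolation {n : ℕ} (ρ : ℂ) (μ : Fin (n + 1) → ℂ) (ξ : Fin n → ℂ)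
    (hμ : Function.Injective μ) (hξ : Function.Injective ξ) (hμξ : ∀ i j, μ i ≠ ξ j)
    (hμρ : ∀ i j, μ i * ρ ≠ ξ j) (X : ℂ) :
    ∑ l : Fin (n + 1), (-1) ^ (l : ℕ) * (Matrix.of fun i j : Fin n =>
        1 / ((μ (l.succAbove i) * ρ - ξ j) * (μ (l.succAbove i) - ξ j))).det *
        ∏ i, (μ (l.succAbove i) - X) * (μ (l.succAbove i) * ρ - X) =
      ∑ l : Fin (n + 1), (-1) ^ (l : ℕ) * (Matrix.of fun i j : Fin n =>
        1 / ((μ (l.succAbove i) * ρ - ξ j) * (μ (l.succAbove i) - ξ j))).det *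
        ((∏ i, (μ (l.succAbove i) - X) * (μ (l.succAbove i) * ρ - μ l)) *
          ∏ j, (X - ξ j) / (μ l - ξ j)) := by
  set m : Fin (n + 1) → ℂ := fun l => (-1) ^ (l : ℕ) * (Matrix.of fun i j : Fin n =>
        1 / ((μ (l.succAbove i) * ρ - ξ j) * (μ (l.succAbove i) - ξ j))).det with hm
  let P : ℂ[X] := ∑ l, C (m l) * ∏ i : Fin n,
    (C (μ (l.succAbove i)) - Polynomial.X) * (C (μ (l.succAbove i) * ρ) - Polynomial.X)
  let Q : ℂ[X] := ∑ l, C (m l) * ((∏ i : Fin n,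
    (C (μ (l.succAbove i)) - Polynomial.X) * C (μ (l.succAbove i) * ρ - μ l)) *
      ∏ j : Fin n, (Polynomial.X - C (ξ j)) * C (μ l - ξ j)⁻¹)
  have hlin : ∀ a : ℂ, (C a - Polynomial.X : ℂ[X]).natDegree ≤ 1 := fun a => by compute_degree
  have hlin' : ∀ a : ℂ, (Polynomial.X - C a : ℂ[X]).natDegree ≤ 1 := fun a => by compute_degree
  have hP : P.natDegree < 2 * n + 1 := by
    refine Nat.lt_succ_of_le (natDegree_sum_le_of_forall_le _ _ fun l _ => ?_)
    refine (natDegree_C_mul_le _ _).trans ((natDegree_prod_le _ _).trans ?_)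
    refine (Finset.sum_le_sum (g := fun _ => 2) fun i _ =>
      natDegree_mul_le.trans (add_le_add (hlin _) (hlin _))).trans ?_
    simp [mul_comm]
  have hQ : Q.natDegree < 2 * n + 1 := by
    refine Nat.lt_succ_of_le (natDegree_sum_le_of_forall_le _ _ fun l _ => ?_)
    refine (natDegree_C_mul_le _ _).trans (natDegree_mul_le.trans ?_)
    have h1 : ∀ p : ℂ[X], p.natDegree ≤ 1 → ∀ a : ℂ, (p * C a).natDegree ≤ 1 := fun p hp a =>
      (natDegree_mul_C_le _ _).trans hp
    refine (add_le_add
      ((natDegree_prod_le _ _).trans (Finset.sum_le_sum (g := fun _ => 1) fun i _ =>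
        h1 _ (hlin _) _))
      ((natDegree_prod_le _ _).trans (Finset.sum_le_sum (g := fun _ => 1) fun i _ =>
        h1 _ (hlin' _) _))).trans ?_
    simp [two_mul]
  have hPe : ∀ x, P.eval x = ∑ l, m l *
      ∏ i, (μ (l.succAbove i) - x) * (μ (l.succAbove i) * ρ - x) := fun x => by
    simp [P, eval_finsetSum, eval_prod]
  have hQe : ∀ x, Q.eval x = ∑ l, m l *
      ((∏ i, (μ (l.succAbove i) - x) * (μ (l.succAbove i) * ρ - μ l)) *
          ∏ j, (x - ξ j) / (μ l - ξ j)) := fun x => by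
    simp [Q, eval_finsetSum, eval_prod, div_eq_mul_inv]
  -- Both degrees are at most `2 * n`, so the `n + 1` nodes `μ` and the `n` nodes `ξ` suffice. At `μ
  -- a` only the summand `l = a` survives on either side.
  have hPQ : P = Q := by
    refine Polynomial.eq_of_natDegree_lt_card_of_eval_eq (ι := Fin (n + 1) ⊕ Fin n) P Q
      (f := Sum.elim μ ξ) ?_ ?_ ?_
    · exact hμ.sumElim hξ hμξ
    · rintro (a | b)
      · have hz : ∀ l ≠ a, ∃ i : Fin n, μ (l.succAbove i) - μ a = 0 := fun l hl => by
          obtain ⟨i, hi⟩ := Fin.exists_succAbove_eq hl.symm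
          exact ⟨i, by rw [hi, sub_self]⟩
        rw [Sum.elim_inl, hPe, hQe, Finset.sum_eq_single a, Finset.sum_eq_single a]
        · have : ∏ j, (μ a - ξ j) / (μ a - ξ j) = 1 :=
            Finset.prod_eq_one fun j _ => div_self (sub_ne_zero.2 (hμξ a j))
          rw [this, mul_one]
        · intro l _ hl
          obtain ⟨i, hi⟩ := hz l hl
          rw [Finset.prod_eq_zero (Finset.mem_univ i) (by rw [hi, zero_mul]), zero_mul, mul_zero]
        · simp
        · intro l _ hl
          obtain ⟨i, hi⟩ := hz l hl
          rw [Finset.prod_eq_zero (Finset.mem_univ i) (by rw [hi, zero_mul]), mul_zero]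
        · simp
      · rw [Sum.elim_inr, hPe, hQe]
        -- At `ξ b` the left side is, up to a factor, the expansion of a determinant in which the
        -- column of `ξ b` occurs twice; the right side has the factor `X - ξ b`.
        have h0 : (Matrix.of fun i j : Fin (n + 1) => 1 /
            ((μ i * ρ - Fin.cons (α := fun _ => ℂ) (ξ b) ξ j) *
              (μ i - Fin.cons (α := fun _ => ℂ) (ξ b) ξ j))).det = 0 :=
          Matrix.det_zero_of_column_eq (Fin.succ_ne_zero b).symm (by simp)
        rw [Matrix.det_succ_column_zero] at h0
        rw [Finset.sum_eq_zero (s := Finset.univ) (f := fun l => m l *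
          ((∏ i, (μ (l.succAbove i) - ξ b) * (μ (l.succAbove i) * ρ - μ l)) *
          ∏ j, (ξ b - ξ j) / (μ l - ξ j)))]
        · have := congrArg (fun t => (∏ i, (μ i - ξ b) * (μ i * ρ - ξ b)) * t) h0
          simp only [mul_zero, Finset.mul_sum] at this
          rw [← this]
          refine Finset.sum_congr rfl fun l _ => ?_
          rw [Fin.prod_univ_succAbove _ l]
          have e1 := sub_ne_zero.2 (hμξ l b)
          have e2 := sub_ne_zero.2 (hμρ l b)
          simp only [hm, Matrix.of_apply, Fin.cons_zero, Matrix.submatrix, Fin.cons_succ]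
          generalize (∏ i : Fin n, (μ (l.succAbove i) - ξ b) * (μ (l.succAbove i) * ρ - ξ b)) = p
          generalize Matrix.det (R := ℂ) (n := Fin n) _ = d
          generalize μ l * ρ - ξ b = t at e2
          field_simp
        · intro l _
          rw [Finset.prod_eq_zero (s := Finset.univ) (f := fun j => (ξ b - ξ j) / (μ l - ξ j))
            (Finset.mem_univ b) (by simp), mul_zero, mul_zero]
    · simp only [Fintype.card_sum, Fintype.card_fin]
      omega
  rw [← hPe, ← hQe, hPQ]

/-- The Vandermonde product with one variable singled out. -/
theorem prod_sub_succAbove {n : ℕ} (v : Fin (n + 1) → ℂ) (l : Fin (n + 1)) :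
    ∏ i, ∏ j ∈ Finset.Ioi i, (v j - v i) = (-1) ^ (l : ℕ) * (∏ i, (v (l.succAbove i) - v l)) *
      ∏ i : Fin n, ∏ j ∈ Finset.Ioi i, (v (l.succAbove j) - v (l.succAbove i)) := by
  -- This permutation brings `l` to the front and keeps the order of the rest; its sign is `(-1) ^
  -- l`.
  have h1 := Matrix.det_permute l.cycleRange.symm (Matrix.vandermonde v)
  have h2 : (Matrix.vandermonde v).submatrix l.cycleRange.symm id =
      Matrix.vandermonde (v ∘ l.cycleRange.symm) := rfl
  rw [h2, Matrix.det_vandermonde, Matrix.det_vandermonde, Equiv.Perm.sign_symm,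
    Fin.sign_cycleRange, Fin.prod_univ_succ, Fin.prod_Ioi_zero] at h1
  simp only [Function.comp, Fin.cycleRange_symm_zero, Fin.cycleRange_symm_succ,
    Fin.prod_Ioi_succ] at h1
  rw [mul_assoc, h1]
  push_cast
  rw [← mul_assoc, ← mul_pow]
  simp

theorem neg_one_pow_mul_prod {n : ℕ} (f : Fin n → ℂ) : (-1) ^ n * ∏ i, f i = ∏ i, -f i := by
  simp [Finset.prod_neg]

/-- The determinant of the Izergin formula, expanded along its first column and interpolated. -/
theorem izergin_det_succ {n : ℕ} (ρ : ℂ) (μ ξ : Fin (n + 1) → ℂ)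
    (hμ : Function.Injective μ) (hξ : Function.Injective ξ) (hμξ : ∀ i j, μ i ≠ ξ j)
    (hμρ : ∀ i j, μ i * ρ ≠ ξ j) :
    (Matrix.of fun i j : Fin (n + 1) => (ρ - 1) / ((μ i * ρ - ξ j) * (μ i - ξ j))).det =
      ∑ l : Fin (n + 1), (-1) ^ (l : ℕ) * (ρ - 1) *
        (Matrix.of fun i j : Fin n => (ρ - 1) /
          ((μ (l.succAbove i) * ρ - ξ j.succ) * (μ (l.succAbove i) - ξ j.succ))).det *
        ((∏ i, (μ (l.succAbove i) - ξ 0) * (μ (l.succAbove i) * ρ - μ l)) *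
          ∏ j : Fin n, (ξ 0 - ξ j.succ) / (μ l - ξ j.succ)) /
        ((μ l - ξ 0) * (μ l * ρ - ξ 0) *
          ∏ i, (μ (l.succAbove i) - ξ 0) * (μ (l.succAbove i) * ρ - ξ 0)) := by
  have hsm : ∀ {k : ℕ} (f : Fin k → Fin k → ℂ), (Matrix.of fun i j => (ρ - 1) / f i j).det =
      (ρ - 1) ^ k * (Matrix.of fun i j => 1 / f i j).det := fun {k} f => by
    have : (Matrix.of fun i j => (ρ - 1) / f i j) =
        (ρ - 1) • (Matrix.of fun i j : Fin k => 1 / f i j) := by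
      ext i j
      simp [div_eq_mul_inv]
    rw [this, Matrix.det_smul, Fintype.card_fin]
  have key := izergin_interpolation ρ μ (fun j : Fin n => ξ j.succ) hμ
    (hξ.comp (Fin.succ_injective n)) (fun i j => hμξ i _) (fun i j => hμρ i _) (ξ 0)
  have hT : ∀ l : Fin (n + 1), (∏ i, (μ i - ξ 0) * (μ i * ρ - ξ 0)) = (μ l - ξ 0) * (μ l * ρ - ξ 0) *
      ∏ i, (μ (l.succAbove i) - ξ 0) * (μ (l.succAbove i) * ρ - ξ 0) := fun l =>
    Fin.prod_univ_succAbove _ l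
  have hT0 : (∏ i, (μ i - ξ 0) * (μ i * ρ - ξ 0)) ≠ 0 :=
    Finset.prod_ne_zero_iff.2 fun i _ =>
      mul_ne_zero (sub_ne_zero.2 (hμξ i 0)) (sub_ne_zero.2 (hμρ i 0))
  simp_rw [hsm, ← hT]
  rw [← Finset.sum_div, eq_div_iff hT0]
  have e1 : ∀ (l : Fin (n + 1)) (m p : ℂ), (-1) ^ (l : ℕ) * (ρ - 1) * ((ρ - 1) ^ n * m) * p =
      (ρ - 1) ^ (n + 1) * ((-1) ^ (l : ℕ) * m * p) := fun l m p => by ring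
  simp_rw [e1]
  rw [← Finset.mul_sum, ← key, mul_assoc]
  congr 1
  rw [Matrix.det_succ_column_zero, Finset.sum_mul]
  refine Finset.sum_congr rfl fun l _ => ?_
  rw [hT l]
  have h1 := sub_ne_zero.2 (hμξ l 0)
  have h2 := sub_ne_zero.2 (hμρ l 0)
  simp only [Matrix.of_apply, Matrix.submatrix]
  generalize (∏ i : Fin n, (μ (l.succAbove i) - ξ 0) * (μ (l.succAbove i) * ρ - ξ 0)) = p
  generalize Matrix.det (R := ℂ) (n := Fin n) _ = d
  generalize μ l * ρ - ξ 0 = t at h2 ⊢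
  field_simp

/-- The Izergin determinant satisfies the recursion of the domain wall partition function. -/
theorem izergin_succ {n : ℕ} {q : ℂ} (hq : q ≠ 0) (u v : Fin (n + 1) → LineParam)
    (hu : ∀ i j, i ≠ j → (u i).spec ≠ (u j).spec) (hv : ∀ i j, i ≠ j → (v i).spec ≠ (v j).spec)
    (huv : ∀ i j, (u i).spec ≠ (v j).spec) (huq : ∀ i j, (u i).spec * q ^ 2 ≠ (v j).spec) :
    izergin (q ^ 2) u v = ∑ l : Fin (n + 1), weightC q (u l).sqrtSpec (v 0).sqrtSpec 1 *
      (∏ i : Fin n, weightB q (u (l.succAbove i)).sqrtSpec (v 0).sqrtSpec *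
        exchangeDirect q (u l).sqrtSpec (u (l.succAbove i)).sqrtSpec) *
      izergin (q ^ 2) (fun i => u (l.succAbove i)) (fun j => v j.succ) := by
  have key := izergin_det_succ (q ^ 2) (fun i => (u i).spec) (fun j => (v j).spec)
    (fun i j h => by_contra fun hij => hu i j hij h) (fun i j h => by_contra fun hij => hv i j hij h)
    huv huq
  rw [izergin, key, Finset.mul_sum]
  refine Finset.sum_congr rfl fun l _ => ?_
  have hV : (∏ p, ∏ r ∈ Finset.Ioi p, ((u p).spec - (u r).spec) * ((v r).spec - (v p).spec)) =
      ((-1) ^ (l : ℕ) * (∏ i : Fin n, ((u l).spec - (u (l.succAbove i)).spec)) *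
        ∏ j : Fin n, ((v j.succ).spec - (v 0).spec)) *
      ∏ p : Fin n, ∏ r ∈ Finset.Ioi p, ((u (l.succAbove p)).spec - (u (l.succAbove r)).spec) *
        ((v r.succ).spec - (v p.succ).spec) := by
    have h1 := prod_sub_succAbove (fun i => -(u i).spec) l
    have h2 := prod_sub_succAbove (fun i => (v i).spec) 0
    simp only [neg_sub_neg, Fin.succAbove_zero, Fin.val_zero, pow_zero, one_mul] at h1 h2
    simp only [Finset.prod_mul_distrib]
    rw [h1, h2]
    ring
  have hW : (∏ m, ∏ k, ((u m).spec - (v k).spec)) = ((u l).spec - (v 0).spec) *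
      (∏ j : Fin n, ((u l).spec - (v j.succ).spec)) *
      ((∏ i : Fin n, ((u (l.succAbove i)).spec - (v 0).spec)) *
        ∏ i : Fin n, ∏ j : Fin n, ((u (l.succAbove i)).spec - (v j.succ).spec)) := by
    rw [Fin.prod_univ_succAbove _ l, Fin.prod_univ_succ]
    simp_rw [Fin.prod_univ_succ, Finset.prod_mul_distrib]
  have hS : (∏ k, (u k).sqrtSpec * (v k).sqrtSpec) = (u l).sqrtSpec * (v 0).sqrtSpec *
      ∏ k : Fin n, (u (l.succAbove k)).sqrtSpec * (v k.succ).sqrtSpec := by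
    rw [Finset.prod_mul_distrib, Fin.prod_univ_succAbove _ l, Fin.prod_univ_succ,
      Finset.prod_mul_distrib]
    ring
  have hne : ∀ i : Fin n, (u l).spec - (u (l.succAbove i)).spec ≠ 0 := fun i =>
    sub_ne_zero.2 (hu _ _ (Fin.succAbove_ne l i).symm)
  have hB : (∏ i : Fin n, weightB q (u (l.succAbove i)).sqrtSpec (v 0).sqrtSpec *
        exchangeDirect q (u l).sqrtSpec (u (l.succAbove i)).sqrtSpec) =
      (∏ i : Fin n, ((u (l.succAbove i)).spec - (v 0).spec)) *
        (∏ i : Fin n, ((u (l.succAbove i)).spec * q ^ 2 - (u l).spec)) /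
      ((∏ i : Fin n, ((u (l.succAbove i)).spec * q ^ 2 - (v 0).spec)) *
        ((-1) ^ n * ∏ i : Fin n, ((u l).spec - (u (l.succAbove i)).spec))) := by
    have : ((-1 : ℂ) ^ n * ∏ i : Fin n, ((u l).spec - (u (l.succAbove i)).spec)) =
        ∏ i : Fin n, ((u (l.succAbove i)).spec - (u l).spec) := by
      rw [neg_one_pow_mul_prod]
      simp only [neg_sub]
    rw [this, ← Finset.prod_mul_distrib, ← Finset.prod_mul_distrib, ← Finset.prod_div_distrib]
    refine Finset.prod_congr rfl fun i _ => ?_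
    simp only [weightB, exchangeDirect, LineParam.sq_sqrtSpec]
    rw [div_mul_div_comm, mul_left_comm _ q, mul_assoc q, mul_div_mul_left _ _ hq]
  have hE : ∏ j : Fin n, ((v 0).spec - (v j.succ).spec) / ((u l).spec - (v j.succ).spec) =
      (-1) ^ n * (∏ j : Fin n, ((v j.succ).spec - (v 0).spec)) /
        ∏ j : Fin n, ((u l).spec - (v j.succ).spec) := by
    rw [Finset.prod_div_distrib]
    congr 1
    rw [neg_one_pow_mul_prod]
    simp only [neg_sub]
  rw [hV, hW, hS, hB, hE, izergin, weightC, LineParam.sq_sqrtSpec, LineParam.sq_sqrtSpec]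
  simp only [Finset.prod_mul_distrib (f := fun i : Fin n => (u (l.succAbove i)).spec - (v 0).spec)]
  have n1 : (∏ j : Fin n, ((u l).spec - (v j.succ).spec)) ≠ 0 :=
    Finset.prod_ne_zero_iff.2 fun i _ => sub_ne_zero.2 (huv _ _)
  have n2 : (∏ i : Fin n, ((u (l.succAbove i)).spec - (v 0).spec)) ≠ 0 :=
    Finset.prod_ne_zero_iff.2 fun i _ => sub_ne_zero.2 (huv _ _)
  have n3 : (∏ i : Fin n, ((u (l.succAbove i)).spec * q ^ 2 - (v 0).spec)) ≠ 0 :=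
    Finset.prod_ne_zero_iff.2 fun i _ => sub_ne_zero.2 (huq _ _)
  have n4 : (∏ i : Fin n, ((u l).spec - (u (l.succAbove i)).spec)) ≠ 0 :=
    Finset.prod_ne_zero_iff.2 fun i _ => hne i
  have n5 : (∏ j : Fin n, ((v j.succ).spec - (v 0).spec)) ≠ 0 :=
    Finset.prod_ne_zero_iff.2 fun i _ => sub_ne_zero.2 (hv _ _ (Fin.succ_ne_zero i))
  have n6 : (u l).spec - (v 0).spec ≠ 0 := sub_ne_zero.2 (huv _ _)
  have n7 : (u l).spec * q ^ 2 - (v 0).spec ≠ 0 := sub_ne_zero.2 (huq _ _)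
  have n8 : (∏ p : Fin n, ∏ r ∈ Finset.Ioi p, ((u (l.succAbove p)).spec - (u (l.succAbove r)).spec) *
        ((v r.succ).spec - (v p.succ).spec)) ≠ 0 := by
    refine Finset.prod_ne_zero_iff.2 fun i _ => Finset.prod_ne_zero_iff.2 fun j hj => ?_
    have hij : i ≠ j := (Finset.mem_Ioi.1 hj).ne
    exact mul_ne_zero (sub_ne_zero.2 (hu _ _ fun h => hij (Fin.succAbove_right_injective h)))
      (sub_ne_zero.2 (hv _ _ fun h => hij (Fin.succ_injective _ h).symm))
  generalize (∏ j : Fin n, ((u l).spec - (v j.succ).spec)) = x1 at *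
  generalize (∏ i : Fin n, ((u (l.succAbove i)).spec - (v 0).spec)) = x2 at *
  generalize (∏ i : Fin n, ((u (l.succAbove i)).spec * q ^ 2 - (v 0).spec)) = x3 at *
  generalize (∏ i : Fin n, ((u l).spec - (u (l.succAbove i)).spec)) = x4 at *
  generalize (∏ j : Fin n, ((v j.succ).spec - (v 0).spec)) = x5 at *
  generalize (∏ p : Fin n, ∏ r ∈ Finset.Ioi p, ((u (l.succAbove p)).spec - (u (l.succAbove r)).spec) *
        ((v r.succ).spec - (v p.succ).spec)) = x6 at *
  generalize (u l).spec - (v 0).spec = x7 at *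
  generalize (u l).spec * q ^ 2 - (v 0).spec = x8 at *
  generalize Matrix.det (R := ℂ) (n := Fin n) _ = d at *
  -- One sign comes from the interpolation ratio in `hE`, the other from the exchange denominators
  -- in `hB`.
  have s1 : ((-1 : ℂ) ^ n) ^ 2 = 1 := by rw [← pow_mul, mul_comm, pow_mul]; simp
  have s2 : (-1 : ℂ) ^ n ≠ 0 := by simp
  have s3 : (-1 : ℂ) ^ (l : ℕ) ≠ 0 := by simp
  generalize (-1 : ℂ) ^ n = s at *
  generalize (-1 : ℂ) ^ (l : ℕ) = s' at *
  field_simp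
  rw [s1, mul_one]

/-- The Izergin expression is symmetric in the column parameters. -/
theorem izergin_comp_perm {M : ℕ} (ρ : ℂ) (u v : Fin M → LineParam) (σ : Equiv.Perm (Fin M)) :
    izergin ρ u (v ∘ σ) = izergin ρ u v := by
  have hdet := Matrix.det_permute' σ (Matrix.of fun i j : Fin M =>
      (ρ - 1) / (((u i).spec * ρ - (v j).spec) * ((u i).spec - (v j).spec)))
  have hvan := Matrix.det_permute σ (Matrix.vandermonde fun j => (v j).spec)
  have h2 : (Matrix.vandermonde fun j => (v j).spec).submatrix σ id =
      Matrix.vandermonde fun j => (v (σ j)).spec := rfl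
  rw [h2, Matrix.det_vandermonde, Matrix.det_vandermonde] at hvan
  have hσ : ((Equiv.Perm.sign σ : ℤ) : ℂ) = 1 ∨ ((Equiv.Perm.sign σ : ℤ) : ℂ) = -1 := by
    rcases Int.units_eq_one_or (Equiv.Perm.sign σ) with h | h <;> simp [h]
  unfold izergin
  have e1 : (∏ k, (u k).sqrtSpec * ((v ∘ σ) k).sqrtSpec) =
      ∏ k, (u k).sqrtSpec * (v k).sqrtSpec := by
    rw [Finset.prod_mul_distrib, Finset.prod_mul_distrib]
    congr 1
    exact Equiv.prod_comp σ fun k => (v k).sqrtSpec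
  have e2 : (∏ m, ∏ n, ((u m).spec - ((v ∘ σ) n).spec)) =
      ∏ m, ∏ n, ((u m).spec - (v n).spec) :=
    Finset.prod_congr rfl fun m _ => Equiv.prod_comp σ fun n => (u m).spec - (v n).spec
  have e3 : (Matrix.of fun i j : Fin M => (ρ - 1) /
      (((u i).spec * ρ - ((v ∘ σ) j).spec) * ((u i).spec - ((v ∘ σ) j).spec))).det =
      ((Equiv.Perm.sign σ : ℤ) : ℂ) * (Matrix.of fun i j : Fin M =>
        (ρ - 1) / (((u i).spec * ρ - (v j).spec) * ((u i).spec - (v j).spec))).det := hdet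
  rw [e1, e2, e3]
  simp only [Finset.prod_mul_distrib, Function.comp, hvan]
  -- The sign of `σ` from the determinant cancels the one from the Vandermonde product.
  rcases hσ with h | h <;> rw [h] <;> ring

/-! ### Spin-chain operators and the recursion for the partition function. -/

section Operators

/-- An operator on `L + 1` sites, given by its blocks with respect to the site `0`. -/
def glue {L : ℕ} (X : Matrix (Fin 2) (Fin 2) (Matrix (Fin L → Fin 2) (Fin L → Fin 2) ℂ)) :
    Matrix (Fin (L + 1) → Fin 2) (Fin (L + 1) → Fin 2) ℂ :=
  Matrix.of fun s t => X (s 0) (t 0) (Fin.tail s) (Fin.tail t)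

variable {L : ℕ}

theorem glue_mul (X Y : Matrix (Fin 2) (Fin 2) (Matrix (Fin L → Fin 2) (Fin L → Fin 2) ℂ)) :
    glue X * glue Y = glue (X * Y) := by
  ext s t
  simp only [glue, Matrix.mul_apply, Matrix.of_apply, Matrix.sum_apply]
  rw [← (Fin.consEquiv fun _ : Fin (L + 1) => Fin 2).sum_comp, Fintype.sum_prod_type]
  simp [Fin.consEquiv]

/-- The blocks of an operator on `L + 1` sites with respect to the site `0`. -/
def unglue (X : Matrix (Fin (L + 1) → Fin 2) (Fin (L + 1) → Fin 2) ℂ) :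
    Matrix (Fin 2) (Fin 2) (Matrix (Fin L → Fin 2) (Fin L → Fin 2) ℂ) :=
  Matrix.of fun a b => Matrix.of fun s t => X (Fin.cons a s) (Fin.cons b t)

theorem glue_unglue (X : Matrix (Fin (L + 1) → Fin 2) (Fin (L + 1) → Fin 2) ℂ) :
    glue (unglue X) = X := by
  ext s t
  simp [glue, unglue]

theorem glue_injective : Function.Injective (glue (L := L)) := fun X Y h => by
  ext a b s t
  simpa [glue] using congrFun (congrFun h (Fin.cons a s)) (Fin.cons b t)

theorem glue_add (X Y : Matrix (Fin 2) (Fin 2) (Matrix (Fin L → Fin 2) (Fin L → Fin 2) ℂ)) :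
    glue (X + Y) = glue X + glue Y := rfl

theorem glue_smul (c : ℂ) (X : Matrix (Fin 2) (Fin 2) (Matrix (Fin L → Fin 2) (Fin L → Fin 2) ℂ)) :
    glue (c • X) = c • glue X := rfl

theorem Exchange.glue {q r k : ℂ}
    {A B A' B' : Matrix (Fin 2) (Fin 2) (Matrix (Fin L → Fin 2) (Fin L → Fin 2) ℂ)}
    (h : Exchange q r k A B A' B') :
    Exchange q r k (glue A) (glue B) (SixVertex.glue A') (SixVertex.glue B') := by
  obtain ⟨h1, h2, h3, h4⟩ := h
  constructor <;> simp only [glue_mul, ← glue_smul, ← glue_add]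
  exacts [congrArg _ h1, congrArg _ h2, congrArg _ h3, congrArg _ h4]

/-- The top row `(A, B)` of the monodromy matrix of a row without field, in terms of a square
root `q` of the anisotropy and a square root `r` of the rapidity. -/
noncomputable def topRow (q r : ℂ) : {L : ℕ} → (Fin L → LineParam) →
    Matrix (Fin L → Fin 2) (Fin L → Fin 2) ℂ × Matrix (Fin L → Fin 2) (Fin L → Fin 2) ℂ
  | 0, _ => (1, 0)
  | _ + 1, v =>
    (glue (blockA q r (v 0).sqrtSpec (v 0).sqrtField (topRow q r fun j => v j.succ).1
      (topRow q r fun j => v j.succ).2),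
     glue (blockB q r (v 0).sqrtSpec (v 0).sqrtField (topRow q r fun j => v j.succ).1
      (topRow q r fun j => v j.succ).2))

theorem exchange_topRow {q r k : ℂ} (hq : q ≠ 0) (hrk : r ^ 2 ≠ k ^ 2) :
    ∀ {L : ℕ} (v : Fin L → LineParam), (∀ j, r ^ 2 * q ^ 2 ≠ (v j).spec) →
      (∀ j, k ^ 2 * q ^ 2 ≠ (v j).spec) →
      Exchange q r k (topRow q r v).1 (topRow q r v).2 (topRow q k v).1 (topRow q k v).2
  | 0, _, _, _ => by constructor <;> simp [topRow]
  | _ + 1, v, hr, hk =>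
    ((exchange_topRow hq hrk (fun j => v j.succ) (fun j => hr _) (fun j => hk _)).block
      (v 0).sqrtSpec (v 0).sqrtField hq hrk (by rw [LineParam.sq_sqrtSpec]; exact hr 0)
      (by rw [LineParam.sq_sqrtSpec]; exact hk 0)).glue

/-- The projection to the reference state. -/
noncomputable def vacuum (L : ℕ) : Matrix (Fin L → Fin 2) (Fin L → Fin 2) ℂ :=
  Matrix.single (fun _ => 0) (fun _ => 0) 1

theorem vacuum_succ (L : ℕ) : vacuum (L + 1) = glue !![vacuum L, 0; 0, 0] := by
  ext s t
  have h : ∀ s : Fin (L + 1) → Fin 2, ((fun _ => 0) = s) ↔ s 0 = 0 ∧ (fun _ => 0) = Fin.tail s := by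
    intro s
    constructor
    · rintro rfl
      exact ⟨rfl, rfl⟩
    · rintro ⟨h0, h1⟩
      funext j
      refine Fin.cases h0.symm (fun j => congrFun h1 j) j
  simp only [vacuum, glue, Matrix.of_apply, Matrix.single_apply, h]
  generalize s 0 = a
  generalize t 0 = b
  fin_cases a <;> fin_cases b <;> simp [Matrix.single_apply]

/-- `blockA` is upper triangular, so on a down spin at site `0` only the smaller `A` acts. -/
theorem topRow_fst_mul_vacuum (q r : ℂ) :
    ∀ {L : ℕ} (v : Fin L → LineParam), (topRow q r v).1 * vacuum L = vacuum L
  | 0, _ => by simp [topRow]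
  | _ + 1, v => by
    rw [vacuum_succ, topRow, glue_mul, blockA]
    congr 1
    ext a b : 2
    fin_cases a <;> fin_cases b <;>
      simp [Matrix.mul_apply, Fin.sum_univ_two, topRow_fst_mul_vacuum q r fun j => v j.succ]

section Core

variable {ι : Type*} [DecidableEq ι]

/-- A family of states built by applying the `B` operators of the rows in a finite set. -/
def IsBethe (q : ℂ) (r : ι → ℂ) (v : Fin L → LineParam)
    (Ψ : Finset ι → Matrix (Fin L → Fin 2) (Fin L → Fin 2) ℂ) : Prop :=
  Ψ ∅ = vacuum L ∧ ∀ S : Finset ι, ∀ i ∉ S, Ψ (insert i S) = (topRow q (r i) v).2 * Ψ S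

/-- The `B`'s commute, so their product over a finite set of rows needs no ordering. -/
theorem exists_isBethe {q : ℂ} {r : ι → ℂ} {v : Fin L → LineParam} (hq : q ≠ 0)
    (hr : ∀ i j, i ≠ j → r i ^ 2 ≠ r j ^ 2) (hv : ∀ i j, r i ^ 2 * q ^ 2 ≠ (v j).spec) :
    ∃ Ψ, IsBethe q r v Ψ := by
  have hc : ∀ i j, Commute (topRow q (r i) v).2 (topRow q (r j) v).2 := fun i j => by
    by_cases h : i = j
    · rw [h]
    · exact (exchange_topRow hq (hr i j h) v (hv i) (hv j)).comm_B
  have hp : ∀ S : Finset ι, (S : Set ι).Pairwise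
      (Function.onFun Commute fun i => (topRow q (r i) v).2) := fun S i _ j _ _ => hc i j
  refine ⟨fun S => S.noncommProd (fun i => (topRow q (r i) v).2) (hp S) * vacuum L, ?_,
    fun S i hi => ?_⟩
  · dsimp only
    rw [Finset.noncommProd_empty, one_mul]
  · dsimp only
    rw [Finset.noncommProd_insert_of_notMem _ _ _ _ hi, mul_assoc]

/-- The rows stay in a fixed type `ι` and `e` selects those in use: the recursion removes one site
and one row, while the hypotheses on `r` remain those for all of `ι`. -/
theorem bethe_eq_izergin {q : ℂ} {r : ι → ℂ} (hq : q ≠ 0)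
    (hr : ∀ i j, i ≠ j → r i ^ 2 ≠ r j ^ 2) :
    ∀ {L : ℕ} (v : Fin L → LineParam) (Ψ : Finset ι → Matrix (Fin L → Fin 2) (Fin L → Fin 2) ℂ)
      (u : Fin L → LineParam) (e : Fin L ↪ ι), (∀ i, (u i).sqrtSpec = r (e i)) →
      (∀ i j, i ≠ j → (v i).spec ≠ (v j).spec) →
      (∀ i j, (u i).spec ≠ (v j).spec) →
      (∀ i j, r i ^ 2 * q ^ 2 ≠ (v j).spec) → IsBethe q r v Ψ →
      Ψ (Finset.univ.map e) (fun _ => 1) (fun _ => 0) =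
        (∏ k, (v k).sqrtField ^ (2 * (k.rev : ℕ) + 1)) * izergin (q ^ 2) u v
  | 0, v, Ψ, u, e, _, _, _, _, hΨ => by
    have : Finset.univ.map e = ∅ := by simp
    rw [this, hΨ.1]
    simp [vacuum, izergin, Matrix.single_apply]
    -- With no sites, the all-up and all-down configurations coincide.
    exact Subsingleton.elim _ _
  | L + 1, v, Ψ, u, e, hue, hv, huv, hrv, hΨ => by
    obtain ⟨Ψ', hΨ'⟩ := exists_isBethe (v := fun j : Fin L => v j.succ) hq hr
      (fun i j => hrv i j.succ)
    have hex := fun i j (hij : i ≠ j) => exchange_topRow hq (hr i j hij)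
      (fun j : Fin L => v j.succ) (fun k => hrv i _) (fun k => hrv j _)
    let Φ : Finset ι → Matrix (Fin 2) (Fin 2) (Matrix (Fin L → Fin 2) (Fin L → Fin 2) ℂ) :=
      fun S => unglue (Ψ S)
    have hΦ : Φ ∅ = !![Ψ' ∅, 0; 0, 0] := by
      apply glue_injective
      rw [glue_unglue, hΨ.1, hΨ'.1, vacuum_succ]
    have hΦB : ∀ (S : Finset ι), ∀ i ∉ S, Φ (insert i S) =
        blockB q (r i) (v 0).sqrtSpec (v 0).sqrtField (topRow q (r i) fun j => v j.succ).1
          (topRow q (r i) fun j => v j.succ).2 * Φ S := fun S i hi => by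
      apply glue_injective
      rw [← glue_mul, glue_unglue, glue_unglue, hΨ.2 S i hi, topRow]
    have key := blockB_bethe hq hr hex (Ψ := Ψ')
      (fun i => by rw [hΨ'.1, topRow_fst_mul_vacuum]) hΨ'.2 (v 0).sqrtSpec (v 0).sqrtField
      (fun i => by rw [LineParam.sq_sqrtSpec]; exact hrv i 0) hΦ hΦB (Finset.univ.map e)
    have h1 : Ψ (Finset.univ.map e) (fun _ => 1) (fun _ => 0) =
        Φ (Finset.univ.map e) 1 0 (fun _ => 1) (fun _ => 0) := by
      rw [← glue_unglue (Ψ (Finset.univ.map e))]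
      rfl
    have herase : ∀ l, (Finset.univ.map e).erase (e l) =
        Finset.univ.map (l.succAboveEmb.trans e) := fun l => by
      rw [← Finset.map_map, Fin.univ_succAbove L l, Finset.cons_eq_insert, Finset.map_insert,
        Finset.erase_insert]
      simp [Fin.succAbove_ne]
    have hu : ∀ i j, i ≠ j → (u i).spec ≠ (u j).spec := fun i j hij => by
      rw [← LineParam.sq_sqrtSpec, ← LineParam.sq_sqrtSpec, hue, hue]
      exact hr _ _ (e.injective.ne hij)
    have huq : ∀ i j, (u i).spec * q ^ 2 ≠ (v j).spec := fun i j => by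
      rw [← LineParam.sq_sqrtSpec, hue]
      exact hrv _ _
    -- Site `0` collects one power of its field root from the off-diagonal weight and two from each
    -- of the other `L` rows, giving the exponent `2 * L + 1`.
    rw [h1, key, izergin_succ hq u v hu hv huv huq, Finset.mul_sum, Fin.prod_univ_succ]
    simp only [Matrix.of_apply, Matrix.cons_val', Matrix.cons_val_zero, Matrix.cons_val_one,
      Matrix.cons_val_fin_one, Finset.sum_map, Matrix.sum_apply, Matrix.smul_apply, herase,
      Finset.prod_map, smul_eq_mul, Finset.prod_mul_distrib, Finset.prod_const]
    refine Finset.sum_congr rfl fun l _ => ?_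
    rw [bethe_eq_izergin hq hr (fun j => v j.succ) Ψ' (fun i => u (l.succAbove i))
      (l.succAboveEmb.trans e) (fun i => hue _)
      (fun i j hij => hv _ _ ((Fin.succ_injective _).ne hij)) (fun i j => huv _ _)
      (fun i j => hrv _ _) hΨ']
    simp only [weightC, hue, Finset.card_map, Finset.card_univ, Fintype.card_fin, Fin.rev_succ, Fin.rev_zero,
      Fin.val_castSucc, Fin.val_last, Function.Embedding.trans_apply, 
      Fin.succAboveEmb_apply]
    ring

end Core

end Operators

/-! ### Removing the row fields from the monodromy matrix. -/

section Monodromy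

variable {L : ℕ}

/-- An operator on the auxiliary space and the sites `1, …, L`, acting as the identity on the
site `0`. -/
def liftTail : Matrix (Fin 2 × (Fin L → Fin 2)) (Fin 2 × (Fin L → Fin 2)) ℂ →*
    Matrix (Fin 2 × (Fin (L + 1) → Fin 2)) (Fin 2 × (Fin (L + 1) → Fin 2)) ℂ where
  toFun X := Matrix.of fun p q =>
    if p.2 0 = q.2 0 then X (p.1, Fin.tail p.2) (q.1, Fin.tail q.2) else 0
  map_one' := by
    ext ⟨a, s⟩ ⟨b, t⟩
    have h : s = t ↔ s 0 = t 0 ∧ Fin.tail s = Fin.tail t := by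
      rw [← Fin.cons_inj (α := fun _ => Fin 2), Fin.cons_self_tail, Fin.cons_self_tail]
    simp only [Matrix.of_apply, Matrix.one_apply, Prod.mk.injEq, h]
    split_ifs <;> simp_all
  map_mul' X Y := by
    ext ⟨a, s⟩ ⟨b, t⟩
    simp only [Matrix.mul_apply, Matrix.of_apply, Fintype.sum_prod_type]
    simp_rw [← (Fin.consEquiv fun _ : Fin (L + 1) => Fin 2).sum_comp, Fintype.sum_prod_type]
    simp only [Fin.consEquiv, Equiv.coe_fn_mk, Fin.cons_zero, Fin.tail_cons]
    by_cases h : s 0 = t 0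
    · simp [h]
    · rw [if_neg h]
      symm
      refine Finset.sum_eq_zero fun c _ => Finset.sum_eq_zero fun d _ =>
        Finset.sum_eq_zero fun r _ => ?_
      by_cases h1 : s 0 = d
      · rw [if_neg (h1 ▸ h : ¬ d = t 0), mul_zero]
      · rw [if_neg h1, zero_mul]

theorem siteR_succ (ρ sρ : ℂ) (u : LineParam) (v : Fin (L + 1) → LineParam) (j : Fin L) :
    siteR ρ sρ u v j.succ = liftTail (siteR ρ sρ u (fun j => v j.succ) j) := by
  ext ⟨a, s⟩ ⟨b, t⟩
  have h : (∀ k, k ≠ j.succ → s k = t k) ↔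
      s 0 = t 0 ∧ ∀ k, k ≠ j → Fin.tail s k = Fin.tail t k := by
    rw [Fin.forall_fin_succ]
    simp [Fin.tail, (Fin.succ_ne_zero j).symm]
  simp only [siteR, liftTail, MonoidHom.coe_mk, OneHom.coe_mk, Matrix.of_apply, h, Fin.tail,
    ite_and]
  congr

/-- Splitting off the first site of the monodromy matrix. -/
theorem monodromy_succ (ρ sρ : ℂ) (u : LineParam) (v : Fin (L + 1) → LineParam) (a b : Fin 2)
    (s t : Fin (L + 1) → Fin 2) :
    monodromy ρ sρ u v (a, s) (b, t) =
      ∑ c, monodromy ρ sρ u (fun j => v j.succ) (a, Fin.tail s) (c, Fin.tail t) *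
        RMatrix ρ sρ u (v 0) (c, s 0) (b, t 0) := by
  have h : monodromy ρ sρ u v =
      liftTail (monodromy ρ sρ u fun j => v j.succ) * siteR ρ sρ u v 0 := by
    rw [monodromy, List.ofFn_succ, List.reverse_cons, List.prod_append, List.prod_singleton,
      monodromy, map_list_prod, List.map_reverse, List.map_ofFn]
    simp only [siteR_succ, Function.comp_def]
  rw [h, Matrix.mul_apply, Fintype.sum_prod_type]
  refine Finset.sum_congr rfl fun c _ => ?_
  -- The lifted factor fixes site `0` and the other factor fixes the tail, so one intermediate state
  -- survives.
  rw [Finset.sum_eq_single (Fin.cons (s 0) (Fin.tail t))]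
  · simp [liftTail, siteR, Fin.forall_fin_succ, Fin.tail]
  · intro r _ hr
    simp only [liftTail, siteR, MonoidHom.coe_mk, OneHom.coe_mk, Matrix.of_apply]
    split_ifs with h1 h2
    · refine absurd ?_ hr
      funext k
      refine Fin.cases h1.symm (fun k => ?_) k
      rw [Fin.cons_succ, h2 _ (Fin.succ_ne_zero k), Fin.tail]
    all_goals simp
  · simp

/-- The number of up spins of a basis state. -/
def charge (s : Fin L → Fin 2) : ℕ := ∑ j, (s j : ℕ)

theorem charge_succ (s : Fin (L + 1) → Fin 2) : charge s = (s 0 : ℕ) + charge (Fin.tail s) :=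
  Fin.sum_univ_succ _

/-- `A` conserves the charge and `B` raises it by one, which makes the gauge factor of each row
constant along a product of `B`'s. -/
theorem topRow_charge (q r : ℂ) : ∀ {L : ℕ} (v : Fin L → LineParam) (s t : Fin L → Fin 2),
    (charge s ≠ charge t → (topRow q r v).1 s t = 0) ∧
      (charge s ≠ charge t + 1 → (topRow q r v).2 s t = 0)
  | 0, _, s, t => by
    have : s = t := Subsingleton.elim _ _
    subst this
    simp [topRow]
  | L + 1, v, s, t => by
    obtain ⟨h1, h2⟩ := topRow_charge q r (fun j => v j.succ) (Fin.tail s) (Fin.tail t)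
    rw [charge_succ, charge_succ]
    simp only [topRow, glue, blockA, blockB, Matrix.of_apply]
    generalize s 0 = a
    generalize t 0 = b
    generalize charge (Fin.tail s) = x at *
    generalize charge (Fin.tail t) = y at *
    fin_cases a <;> fin_cases b <;> constructor <;> intro h <;>
      simp at h ⊢
    all_goals first
      | exact h1 (by omega)
      | exact h2 (by omega)
      | exact Or.inr (h1 (by omega))
      | exact Or.inr (h2 (by omega))

/-- The top row of the monodromy matrix of a row with a field. -/
theorem monodromy_eq_topRow (q : ℂ) (u : LineParam) :
    ∀ {L : ℕ} (v : Fin L → LineParam) (s t : Fin L → Fin 2),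
      monodromy (q ^ 2) q u v (0, s) (0, t) =
        (u.sqrtField)⁻¹ ^ (charge s + charge t) * (topRow q u.sqrtSpec v).1 s t ∧
      monodromy (q ^ 2) q u v (0, s) (1, t) =
        (u.sqrtField)⁻¹ ^ (charge s + charge t) * (topRow q u.sqrtSpec v).2 s t
  | 0, _, s, t => by
    have : s = t := Subsingleton.elim _ _
    subst this
    simp [topRow, monodromy, charge]
  | L + 1, v, s, t => by
    obtain ⟨h1, h2⟩ := monodromy_eq_topRow q u (fun j => v j.succ) (Fin.tail s) (Fin.tail t)
    rw [monodromy_succ, monodromy_succ, charge_succ, charge_succ, Fin.sum_univ_two,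
      Fin.sum_univ_two, h1, h2]
    simp only [topRow, glue, blockA, blockB, Matrix.of_apply, weightB, weightC, RMatrix, weights,
      ← u.sq_sqrtField, ← u.sq_sqrtSpec, ← (v 0).sq_sqrtField, ← (v 0).sq_sqrtSpec]
    generalize s 0 = a
    generalize t 0 = b
    generalize charge (Fin.tail s) = x
    generalize charge (Fin.tail t) = y
    fin_cases a <;> fin_cases b <;> constructor <;> simp [finProdFinEquiv]
    all_goals ring

end Monodromy

theorem prod_opB_eq (q : ℂ) {L : ℕ} (v : Fin L → LineParam) :
    ∀ {n : ℕ} (u : Fin n → LineParam) (s : Fin L → Fin 2),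
      (List.ofFn fun i => opB (q ^ 2) q (u i) v).prod s (fun _ => 0) =
        (∏ k, ((u k).sqrtField)⁻¹ ^ (2 * (k.rev : ℕ) + 1)) *
          (List.ofFn fun i => (topRow q (u i).sqrtSpec v).2).prod s (fun _ => 0) ∧
      (charge s ≠ n →
        (List.ofFn fun i => (topRow q (u i).sqrtSpec v).2).prod s (fun _ => 0) = 0)
  | 0, u, s => by
    refine ⟨by simp, fun h => ?_⟩
    rw [List.ofFn_zero, List.prod_nil, Matrix.one_apply_ne]
    rintro rfl
    simp [charge] at h
  | n + 1, u, s => by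
    have ih := fun t => prod_opB_eq q v (fun i => u i.succ) t
    simp only [List.ofFn_succ, List.prod_cons, Matrix.mul_apply]
    constructor
    · rw [Fin.prod_univ_succ, Finset.mul_sum]
      refine Finset.sum_congr rfl fun t _ => ?_
      rw [(ih t).1]
      -- Only a step from charge `n` to `n + 1` contributes, so the leftmost row yields the exponent
      -- `2 * n + 1`.
      by_cases ht : charge t = n
      · by_cases hs : charge s = n + 1
        · simp only [opB, Matrix.of_apply]
          rw [(monodromy_eq_topRow q (u 0) v s t).2, ht, hs]
          simp only [Fin.rev_zero, Fin.val_last, Fin.rev_succ, Fin.val_castSucc]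
          ring
        · have h0 := (topRow_charge q (u 0).sqrtSpec v s t).2 (by rw [ht]; exact hs)
          simp only [opB, Matrix.of_apply]
          rw [(monodromy_eq_topRow q (u 0) v s t).2, h0]
          simp
      · rw [(ih t).2 ht]
        simp
    · intro hs
      refine Finset.sum_eq_zero fun t _ => ?_
      by_cases ht : charge t = n
      · rw [(topRow_charge q (u 0).sqrtSpec v s t).2 (by rw [ht]; exact hs), zero_mul]
      · rw [(ih t).2 ht, mul_zero]

theorem IsBethe.apply_map {ι : Type*} [DecidableEq ι] {q : ℂ} {r : ι → ℂ} {L : ℕ}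
    {v : Fin L → LineParam} {Ψ : Finset ι → Matrix (Fin L → Fin 2) (Fin L → Fin 2) ℂ}
    (hΨ : IsBethe q r v Ψ) : ∀ {n : ℕ} (e : Fin n ↪ ι),
      Ψ (Finset.univ.map e) = (List.ofFn fun i => (topRow q (r (e i)) v).2).prod * vacuum L
  | 0, e => by
    have : Finset.univ.map e = ∅ := by simp
    rw [this, hΨ.1]
    simp
  | n + 1, e => by
    have h1 : Finset.univ.map e = insert (e 0) (Finset.univ.map ((Fin.succEmb n).trans e)) := by
      rw [← Finset.map_map, Fin.univ_succ, Finset.cons_eq_insert, Finset.map_insert]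
      rfl
    rw [h1, hΨ.2 _ _ (by simp), hΨ.apply_map, List.ofFn_succ, List.prod_cons, mul_assoc]
    rfl

theorem dwpfB_eq_of_ne_zero {M : ℕ} {q : ℂ} (hq : q ≠ 0) (u v : Fin M → LineParam)
    (hu : ∀ i j, i ≠ j → (u i).spec ≠ (u j).spec) (hv : ∀ i j, i ≠ j → (v i).spec ≠ (v j).spec)
    (huv : ∀ i j, (u i).spec ≠ (v j).spec) (huq : ∀ i j, (u i).spec * q ^ 2 ≠ (v j).spec) :
    dwpfB (q ^ 2) q u v =
      (∏ k, ((v k).sqrtField / (u k).sqrtField) ^ (2 * (k.rev : ℕ) + 1)) *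
        izergin (q ^ 2) u v := by
  have hr : ∀ i j, i ≠ j → (u i).sqrtSpec ^ 2 ≠ (u j).sqrtSpec ^ 2 := fun i j hij => by
    rw [LineParam.sq_sqrtSpec, LineParam.sq_sqrtSpec]
    exact hu i j hij
  have hrq : ∀ i j, (u i).sqrtSpec ^ 2 * q ^ 2 ≠ (v j).spec := fun i j => by
    rw [LineParam.sq_sqrtSpec]
    exact huq i j
  obtain ⟨Ψ, hΨ⟩ := exists_isBethe (v := v) (r := fun i => (u i).sqrtSpec) hq hr hrq
  have h1 := bethe_eq_izergin hq hr v Ψ u (Function.Embedding.refl _) (fun _ => rfl) hv huv hrq hΨ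
  have h2 : (List.ofFn fun i => (topRow q (u i).sqrtSpec v).2).prod (fun _ => 1) (fun _ => 0) =
      (∏ k, (v k).sqrtField ^ (2 * (k.rev : ℕ) + 1)) * izergin (q ^ 2) u v := by
    -- The reference state is a rank-one matrix so that states lie in the operator ring; multiplying
    -- by it on the right keeps just the all-down column.
    rw [← h1, hΨ.apply_map, vacuum, Matrix.mul_single_apply_same, mul_one]
    rfl
  rw [dwpfB, (prod_opB_eq q v u _).1, h2, ← mul_assoc, ← Finset.prod_mul_distrib]
  congr 1
  exact Finset.prod_congr rfl fun k _ => by rw [div_eq_mul_inv, mul_pow, mul_comm]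

/-! ### Continuity in the square root of the anisotropy. -/

theorem continuousAt_siteR {L : ℕ} (u : LineParam) (v : Fin L → LineParam) (q₀ : ℂ)
    (h : ∀ j, u.spec * q₀ ^ 2 ≠ (v j).spec) (j : Fin L) :
    ContinuousAt (fun q => siteR (q ^ 2) q u v j) q₀ := by
  have h0 : u.spec * q₀ ^ 2 - (v j).spec ≠ 0 := sub_ne_zero.2 (h j)
  have hw : ∀ a b, ContinuousAt (fun q => weights (q ^ 2) q u (v j) a b) q₀ := fun a b => by
    fin_cases a <;> fin_cases b <;> simp [weights] <;> fun_prop (disch := assumption)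
  refine continuousAt_pi.2 fun p => continuousAt_pi.2 fun p' => ?_
  simp only [siteR, Matrix.of_apply]
  split_ifs
  · exact hw _ _
  · exact continuousAt_const

theorem continuousAt_dwpfB {M : ℕ} (u v : Fin M → LineParam) (q₀ : ℂ)
    (h : ∀ i j, (u i).spec * q₀ ^ 2 ≠ (v j).spec) :
    ContinuousAt (fun q => dwpfB (q ^ 2) q u v) q₀ := by
  have hT : ∀ i, ContinuousAt (fun q => monodromy (q ^ 2) q (u i) v) q₀ := fun i => by
    simp only [monodromy, List.ofFn_eq_map, ← List.map_reverse]
    exact tendsto_list_prod _ fun j _ => continuousAt_siteR (u i) v q₀ (h i) j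
  have hB : ContinuousAt
      (fun q => ((List.finRange M).map fun i => opB (q ^ 2) q (u i) v).prod) q₀ :=
    tendsto_list_prod _ fun i _ => tendsto_pi_nhds.2 fun s => tendsto_pi_nhds.2 fun t =>
      tendsto_pi_nhds.1 (tendsto_pi_nhds.1 (hT i) _) _
  simp only [dwpfB, List.ofFn_eq_map]
  exact tendsto_pi_nhds.1 (tendsto_pi_nhds.1 hB _) _

theorem continuousAt_izergin {M : ℕ} (u v : Fin M → LineParam) (ρ₀ : ℂ)
    (huv : ∀ i j, (u i).spec ≠ (v j).spec) (h : ∀ i j, (u i).spec * ρ₀ ≠ (v j).spec) :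
    ContinuousAt (fun ρ => izergin ρ u v) ρ₀ := by
  unfold izergin
  refine ContinuousAt.mul continuousAt_const ?_
  have : ContinuousAt (fun ρ => (Matrix.of fun i j : Fin M =>
      (ρ - 1) / (((u i).spec * ρ - (v j).spec) * ((u i).spec - (v j).spec)))) ρ₀ := by
    refine continuousAt_pi.2 fun i => continuousAt_pi.2 fun j => ?_
    have h0 : ((u i).spec * ρ₀ - (v j).spec) * ((u i).spec - (v j).spec) ≠ 0 :=
      mul_ne_zero (sub_ne_zero.2 (h i j)) (sub_ne_zero.2 (huv i j))
    simp only [Matrix.of_apply]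
    fun_prop (disch := assumption)
  exact (continuous_id.matrix_det.continuousAt (x := _)).comp this

/-- The type-`B` domain wall partition function, for any anisotropy. -/
theorem dwpfB_eq {M : ℕ} (q : ℂ) (u v : Fin M → LineParam)
    (hu : ∀ i j, i ≠ j → (u i).spec ≠ (u j).spec) (hv : ∀ i j, i ≠ j → (v i).spec ≠ (v j).spec)
    (huv : ∀ i j, (u i).spec ≠ (v j).spec) (huq : ∀ i j, (u i).spec * q ^ 2 ≠ (v j).spec) :
    dwpfB (q ^ 2) q u v =
      (∏ k, ((v k).sqrtField / (u k).sqrtField) ^ (2 * (k.rev : ℕ) + 1)) *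
        izergin (q ^ 2) u v := by
  have hf := continuousAt_dwpfB u v q huq
  have hg : ContinuousAt (fun q =>
      (∏ k, ((v k).sqrtField / (u k).sqrtField) ^ (2 * (k.rev : ℕ) + 1)) *
        izergin (q ^ 2) u v) q :=
    continuousAt_const.mul
      ((continuousAt_izergin u v (q ^ 2) huv huq).comp (f := fun q : ℂ => q ^ 2) (by fun_prop))
  have hne : ∀ᶠ p in nhds q, ∀ i j, (u i).spec * p ^ 2 ≠ (v j).spec := by
    refine Filter.eventually_all.2 fun i => Filter.eventually_all.2 fun j => ?_
    exact ContinuousAt.eventually_ne (g := fun p => (u i).spec * p ^ 2) (by fun_prop) (huq i j)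
  have hne0 : ∀ᶠ p in nhdsWithin q {q}ᶜ, p ≠ 0 := by
    by_cases h : q = 0
    · subst h
      exact self_mem_nhdsWithin
    · exact nhdsWithin_le_nhds (isOpen_ne.mem_nhds h)
  -- The two sides agree on a punctured neighbourhood of `q`, where the parameter is nonzero and the
  -- denominators stay nonzero.
  refine tendsto_nhds_unique_of_eventuallyEq (hf.tendsto.mono_left nhdsWithin_le_nhds)
    (hg.tendsto.mono_left nhdsWithin_le_nhds) (l := nhdsWithin q {q}ᶜ) ?_
  filter_upwards [nhdsWithin_le_nhds hne, hne0] with p hp hp0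
  exact dwpfB_eq_of_ne_zero hp0 u v hu hv huv hp

/-! ### From type `B` to type `C` by transposition. -/

theorem weights_symm (ρ sρ : ℂ) (u v : LineParam) (i j : Fin 4) :
    weights ρ sρ u v i j = weights ρ sρ u v j i := by
  fin_cases i <;> fin_cases j <;> rfl

/-- Reversal of the order of the sites on basis states. -/
def revSpins (M : ℕ) : (Fin M → Fin 2) ≃ (Fin M → Fin 2) := Fin.revPerm.arrowCongr (Equiv.refl _)

theorem siteR_transpose {M : ℕ} (ρ sρ : ℂ) (u : LineParam) (v : Fin M → LineParam) (j : Fin M) :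
    (siteR ρ sρ u v j.rev).transpose = Matrix.reindexAlgEquiv ℂ ℂ
      ((Equiv.refl (Fin 2)).prodCongr (revSpins M)) (siteR ρ sρ u (v ∘ Fin.rev) j) := by
  ext ⟨a, s⟩ ⟨b, t⟩
  have h : (∀ k, k ≠ j.rev → t k = s k) ↔ ∀ k, k ≠ j → s k.rev = t k.rev := by
    rw [← Fin.revPerm.forall_congr_right]
    simp only [Fin.revPerm_apply, ne_eq, Fin.rev_inj, eq_comm]
  simp only [siteR, Matrix.transpose_apply, Matrix.of_apply, h, Matrix.coe_reindexAlgEquiv,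
    Matrix.reindex_apply, Matrix.submatrix_apply, RMatrix]
  rw [weights_symm]
  rfl

/-- Each factor is symmetric, so transposing only reverses the order of the product; relabelling the
sites backwards restores it. -/
theorem monodromy_transpose {M : ℕ} (ρ sρ : ℂ) (u : LineParam) (v : Fin M → LineParam) :
    (monodromy ρ sρ u v).transpose = Matrix.reindexAlgEquiv ℂ ℂ
      ((Equiv.refl (Fin 2)).prodCongr (revSpins M)) (monodromy ρ sρ u (v ∘ Fin.rev)) := by
  rw [monodromy, monodromy, Matrix.transpose_list_prod, map_list_prod, List.map_reverse,
    List.reverse_reverse, List.map_ofFn, List.map_reverse, List.map_ofFn, List.ofFn_eq_map,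
    List.ofFn_eq_map, ← List.map_reverse, List.finRange_reverse, List.map_map]
  congr 2
  funext j
  have := siteR_transpose ρ sρ u v j.rev
  rw [Fin.rev_rev] at this
  exact this

theorem opC_transpose {M : ℕ} (ρ sρ : ℂ) (u : LineParam) (v : Fin M → LineParam) :
    (opC ρ sρ u v).transpose =
      Matrix.reindexAlgEquiv ℂ ℂ (revSpins M) (opB ρ sρ u (v ∘ Fin.rev)) := by
  ext s t
  exact congrFun (congrFun (monodromy_transpose ρ sρ u v) (0, s)) (1, t)

theorem dwpfC_eq_dwpfB {M : ℕ} (ρ sρ : ℂ) (u v : Fin M → LineParam) :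
    dwpfC ρ sρ u v = dwpfB ρ sρ u (v ∘ Fin.rev) := by
  have h : (List.ofFn fun i => opC ρ sρ (u i) v).reverse.prod.transpose =
      Matrix.reindexAlgEquiv ℂ ℂ (revSpins M)
        (List.ofFn fun i => opB ρ sρ (u i) (v ∘ Fin.rev)).prod := by
    rw [Matrix.transpose_list_prod, map_list_prod, List.map_reverse, List.reverse_reverse,
      List.map_ofFn, List.map_ofFn]
    simp only [Function.comp_def, opC_transpose]
  exact congrFun (congrFun h fun _ => 1) fun _ => 0

end SixVertex

/-- With indices running from `0` to `M - 1`, `k.rev = M - 1 - k`, so that the exponent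
`2 * k.rev + 1` of a square root is `2 * M - 2 * k + 1` for the index `k` counted from `1`. -/
theorem mainTheorem6 (M : ℕ) (ρ sρ : ℂ) (hρ : sρ ^ 2 = ρ) (v : Fin M → SixVertex.LineParam)
    (hv : ∀ i j, i ≠ j → (v i).spec ≠ (v j).spec) :
    (∀ u : Fin M → SixVertex.LineParam,
      (∀ i, (u i).field ≠ 0) →
      (∀ i j, i ≠ j → (u i).spec ≠ (u j).spec) →
      (∀ i j, (u i).spec ≠ (v j).spec) →
      (∀ i j, (u i).spec * ρ ≠ (v j).spec) →
      SixVertex.dwpfB ρ sρ u v =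
        (∏ k, ((v k).sqrtField / (u k).sqrtField) ^ (2 * (k.rev : ℕ) + 1)) *
          SixVertex.izergin ρ u v) ∧
    (∀ w : Fin M → SixVertex.LineParam,
      (∀ i, (w i).field ≠ 0) →
      (∀ i j, i ≠ j → (w i).spec ≠ (w j).spec) →
      (∀ i j, (w i).spec ≠ (v j).spec) →
      (∀ i j, (w i).spec * ρ ≠ (v j).spec) →
      SixVertex.dwpfC ρ sρ w v =
        (∏ k, ((v k.rev).sqrtField / (w k).sqrtField) ^ (2 * (k.rev : ℕ) + 1)) *
          SixVertex.izergin ρ w v) := by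
  subst hρ
  refine ⟨fun u _ hu huv huq => SixVertex.dwpfB_eq sρ u v hu hv huv huq,
    fun w _ hw hwv hwq => ?_⟩
  rw [SixVertex.dwpfC_eq_dwpfB, SixVertex.dwpfB_eq sρ w (v ∘ Fin.rev) hw
    (fun i j hij => hv _ _ (Fin.rev_injective.ne hij)) (fun i j => hwv i _) (fun i j => hwq i _)]
  -- The reversed columns remain visible only in the field prefactor.
  exact congrArg _ (SixVertex.izergin_comp_perm _ w v Fin.revPerm)
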